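/- Let $P=(X,\prec)$ be a finite partially ordered set with $|X|=n$. A linear extension of $P$ is a bijection $f:X\to\{1,\ldots,n\}$ such that $x\prec y$ implies $f(x)<f(y)$. Let $\mathbf{P}$ denote probability with respect to a uniformly random linear extension $f$ of $P$. For $A\subseteq X$ write $A{\uparrow}:=\{x\in X : x\succcurlyeq a \text{ for some } a\in A\}$ for the upper closure of $A$. Let $A$ and $B$ be disjoint nonempty sets of minimal elements of $P$. Then $$\mathbf{P}\big[1\in f(A),\ 2\in f(B)\big]^2\ \ge\ \mathbf{P}\big[1\in f(A),\ 2\in f(A{\uparrow})\big]\cdot \mathbf{P}\big[1\in f(B),\ 2\in f(B{\uparrow})\big].$$ -/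

import Mathlib

open MeasureTheory ProbabilityTheory

/-- A linear extension of a finite poset `X` with `n` elements: a bijection from `X` onto
`{1, …, n}` that is order-preserving, i.e. `x < y` implies `f x < f y`. -/
structure LinExt (X : Type*) [Fintype X] [PartialOrder X] where
  /-- the underlying bijection -/
  toEquiv : X ≃ Set.Icc 1 (Fintype.card X)
  lt_of_lt : ∀ x y : X, x < y → toEquiv x < toEquiv y

namespace LinExt

variable {X : Type*} [Fintype X] [PartialOrder X]

/-- A linear extension is used as a function to `ℕ` (with values in `{1, …, n}`). -/
instance : CoeFun (LinExt X) (fun _ => X → ℕ) := ⟨fun f x => (f.toEquiv x : ℕ)⟩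

theorem toEquiv_injective :
    Function.Injective (toEquiv : LinExt X → (X ≃ Set.Icc 1 (Fintype.card X))) := by
  rintro ⟨f, hf⟩ ⟨g, hg⟩ h
  cases h
  rfl

instance : Finite (LinExt X) := Finite.of_injective _ toEquiv_injective

/-- Every finite poset has a linear extension. -/
instance : Nonempty (LinExt X) := by
  classical
  let _ : Fintype (LinearExtension X) := ‹Fintype X›
  have hc : Fintype.card (Set.Icc 1 (Fintype.card X)) = Fintype.card X := by simp
  let e₁ : Fin (Fintype.card X) ≃o LinearExtension X :=
    Fintype.orderIsoFinOfCardEq (LinearExtension X) rfl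
  let e₂ : Fin (Fintype.card X) ≃o Set.Icc 1 (Fintype.card X) :=
    Fintype.orderIsoFinOfCardEq _ hc
  let e₀ : X ≃ LinearExtension X := Equiv.refl X
  refine ⟨⟨e₀.trans (e₁.symm.trans e₂).toEquiv, fun x y hxy => ?_⟩⟩
  have h : toLinearExtension x < toLinearExtension y :=
    lt_of_le_of_ne (toLinearExtension.monotone hxy.le) hxy.ne
  exact (e₁.symm.trans e₂).strictMono h

/-- Every set of linear extensions is an event. -/
instance : MeasurableSpace (LinExt X) := ⊤

instance : MeasurableSingletonClass (LinExt X) := ⟨fun _ => trivial⟩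

/-- The law of a uniformly random linear extension of `X`. -/
noncomputable def unif (X : Type*) [Fintype X] [PartialOrder X] : Measure (LinExt X) :=
  uniformOn Set.univ

instance : IsProbabilityMeasure (unif X) :=
  isProbabilityMeasure_uniformOn Set.finite_univ Set.univ_nonempty

end LinExt

/-! Weight each linear extension by `v` at its first element and by `w` at its second, where a
second element that is not minimal in the poset takes the weight of the first, which lies below it.
This defines a symmetric form Q. On the indicators of A and B its values Q(A,B), Q(A,A), Q(B,B) are
the three counts in the theorem, so the claim is the reversed Cauchy–Schwarz inequality for Q
(`firstTwoForm_mul_le`).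

That inequality is proved by induction on the size of the poset. Let M be the matrix of Q, and let
Q_x be the form of the poset without the minimal element x, with v_x the inherited weight. Then
(Mv)_x = Q_x(v_x,1), and row x of M has sum D_x = Q_x(1,1). The combinatorial inequality Q(v,v) ≤ ∑
Q_x(v_x,v_x) (`firstTwoForm_succ_le`) and induction give v·Mv ≤ ∑ (Mv)_x²/D_x.

Hence each eigenvalue λ of D⁻¹M satisfies λ ≤ λ², so a positive one is at least 1. Positivity off
the diagonal rules this out for nonconstant eigenvectors, so constants are the only positive
direction. -/

/-! ### Spectral criterion for the reversed Cauchy–Schwarz inequality -/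

section Hyperbolic

open Matrix

variable {ι : Type*} [Fintype ι]

/-- Simultaneous diagonalization of a symmetric matrix and a positive diagonal form. -/
theorem Matrix.IsSymm.exists_diagonalization {M : Matrix ι ι ℝ} (hM : M.IsSymm) {d : ι → ℝ}
    (hd : ∀ i, 0 < d i) :
    ∃ (p : ι → ι → ℝ) (l : ι → ℝ), (∀ i k, (M *ᵥ p i) k = l i * (d k * p i k)) ∧
      (∀ i, ∑ k, d k * p i k ^ 2 = 1) ∧
      ∀ u : ι → ℝ, u = ∑ i, (∑ k, d k * u k * p i k) • p i := by
  classical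
  let s : ι → ℝ := fun i => √(d i)
  have hs : ∀ i, 0 < s i := fun i => Real.sqrt_pos.2 (hd i)
  have hss : ∀ i, s i * s i = d i := fun i => Real.mul_self_sqrt (hd i).le
  -- With D = diag(d), this is D^(-1/2) M D^(-1/2). Its orthonormal eigenvectors, rescaled by
  -- D^(-1/2), are the `p i`.
  let S : Matrix ι ι ℝ := Matrix.of fun i j => M i j / (s i * s j)
  have hS : S.IsHermitian := by
    ext i j
    simp [S, hM.apply i j, mul_comm]
  let b := hS.eigenvectorBasis
  refine ⟨fun i k => b i k / s k, hS.eigenvalues, fun i k => ?_, fun i => ?_, fun u => ?_⟩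
  · have h := congrFun (hS.mulVec_eigenvectorBasis i) k
    simp only [mulVec, dotProduct, S, Matrix.of_apply, Pi.smul_apply, smul_eq_mul] at h ⊢
    have h2 : ∑ x, M k x * (b i x / s x) = s k * ∑ x, M k x / (s k * s x) * b i x := by
      rw [Finset.mul_sum]
      refine Finset.sum_congr rfl fun x _ => ?_
      have := (hs x).ne'
      have := (hs k).ne'
      field_simp
    rw [h2, ← hss k]
    erw [h]
    have := (hs k).ne'
    field_simp
    rfl
  · have h := b.orthonormal.1 i
    rw [EuclideanSpace.norm_eq, Real.sqrt_eq_one] at h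
    rw [← h]
    refine Finset.sum_congr rfl fun k _ => ?_
    have := (hs k).ne'
    rw [← hss k, Real.norm_eq_abs, sq_abs]
    field_simp
  · have h := b.sum_repr' (WithLp.toLp 2 fun k => s k * u k)
    ext k
    have hk := congrArg (fun x : EuclideanSpace ℝ ι => x k / s k) h
    have := (hs k).ne'
    simp only [WithLp.ofLp_sum, WithLp.ofLp_smul, Finset.sum_apply, Pi.smul_apply, smul_eq_mul,
      PiLp.inner_apply, RCLike.inner_apply, conj_trivial] at hk ⊢
    rw [mul_div_cancel_left₀ _ this] at hk
    rw [← hk, Finset.sum_div]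
    refine Finset.sum_congr rfl fun i _ => ?_
    rw [mul_div_assoc]
    congr 1
    refine Finset.sum_congr rfl fun j _ => ?_
    have := (hs j).ne'
    rw [← hss j]
    field_simp

/-- The Dirichlet form of a symmetric matrix. -/
theorem Matrix.IsSymm.sum_mul_sub_sq {M : Matrix ι ι ℝ} (hM : M.IsSymm) (p : ι → ℝ) :
    ∑ i, ∑ j, M i j * (p i - p j) ^ 2 =
      2 * (∑ i, (∑ j, M i j) * p i ^ 2 - p ⬝ᵥ M *ᵥ p) := by
  have h1 : ∑ i, ∑ j, M i j * p j ^ 2 = ∑ i, ∑ j, M i j * p i ^ 2 := by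
    rw [Finset.sum_comm]
    simp_rw [hM.apply]
  have h2 : ∑ i, ∑ j, M i j * (p i - p j) ^ 2 = ∑ i, ∑ j, M i j * p i ^ 2 +
      ∑ i, ∑ j, M i j * p j ^ 2 - 2 * ∑ i, ∑ j, p i * (M i j * p j) := by
    simp only [Finset.mul_sum, ← Finset.sum_add_distrib, ← Finset.sum_sub_distrib]
    refine Finset.sum_congr rfl fun i _ => Finset.sum_congr rfl fun j _ => ?_
    ring
  simp only [dotProduct, mulVec, Finset.mul_sum, Finset.sum_mul] at h2 ⊢
  rw [h2, h1]
  simp only [← Finset.mul_sum]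
  ring

theorem Matrix.IsSymm.dotProduct_mulVec_comm {M : Matrix ι ι ℝ} (hM : M.IsSymm) (v w : ι → ℝ) :
    v ⬝ᵥ M *ᵥ w = w ⬝ᵥ M *ᵥ v := by
  rw [dotProduct_mulVec, ← mulVec_transpose, hM.eq, dotProduct_comm]

/-- A symmetric form whose eigenvalues with respect to the row sums avoid `(0, 1)` is
nonpositive on the orthogonal complement of the constant vectors. -/
theorem Matrix.IsSymm.dotProduct_mulVec_nonpos {M : Matrix ι ι ℝ} (hM : M.IsSymm)
    (hoff : ∀ i j, i ≠ j → 0 < M i j) (hrow : ∀ i, 0 < ∑ j, M i j)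
    (hpull : ∀ v : ι → ℝ, v ⬝ᵥ M *ᵥ v ≤ ∑ i, (M *ᵥ v) i ^ 2 / ∑ j, M i j)
    (u : ι → ℝ) (hu : 1 ⬝ᵥ M *ᵥ u = 0) : u ⬝ᵥ M *ᵥ u ≤ 0 := by
  obtain ⟨p, l, hp, hn, hr⟩ := hM.exists_diagonalization hrow
  have hform : ∀ i (w : ι → ℝ),
      w ⬝ᵥ M *ᵥ p i = l i * ∑ k, (∑ j, M k j) * w k * p i k := by
    intro i w
    simp only [dotProduct, hp, Finset.mul_sum (a := l i)]
    refine Finset.sum_congr rfl fun k _ => ?_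
    ring
  have hself : ∀ i, p i ⬝ᵥ M *ᵥ p i = l i := by
    intro i
    rw [hform]
    conv_rhs => rw [← mul_one (l i), ← hn i]
    congr 1
    exact Finset.sum_congr rfl fun k _ => by ring
  have hu' : ∑ k, (∑ j, M k j) * u k = 0 := by
    rw [← hu, hM.dotProduct_mulVec_comm]
    simp only [dotProduct, mulVec, Pi.one_apply, mul_one]
    exact Finset.sum_congr rfl fun k _ => by ring
  have key : u ⬝ᵥ M *ᵥ u = ∑ i, l i * (∑ k, (∑ j, M k j) * u k * p i k) ^ 2 := by
    conv_lhs => rw [hr u]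
    rw [sum_dotProduct]
    refine Finset.sum_congr rfl fun i _ => ?_
    rw [smul_dotProduct, ← hr u, hM.dotProduct_mulVec_comm, hform, smul_eq_mul]
    ring
  rw [key]
  refine Finset.sum_nonpos fun i _ => ?_
  rcases le_or_gt (l i) 0 with hl | hl
  · exact mul_nonpos_of_nonpos_of_nonneg hl (sq_nonneg _)
  -- For an eigenvector, `hpull` reads l ≤ l².
  have h1 : 1 ≤ l i := by
    have h := hpull (p i)
    have h2 : ∑ k, (M *ᵥ p i) k ^ 2 / ∑ j, M k j = l i ^ 2 := by
      rw [← mul_one (l i ^ 2), ← hn i, Finset.mul_sum]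
      refine Finset.sum_congr rfl fun k _ => ?_
      have := (hrow k).ne'
      rw [hp]
      field_simp
    rw [h2, hself] at h
    nlinarith
  -- The Dirichlet form of `p i` equals 2(1 - l) ≤ 0, yet its off-diagonal weights are positive, so
  -- every difference vanishes.
  have hconst : ∀ k j, p i k = p i j := by
    intro k j
    by_contra hne
    have hkj : k ≠ j := fun h => hne (h ▸ rfl)
    have h := hM.sum_mul_sub_sq (p i)
    rw [hn, hself] at h
    have hnn : ∀ a b, 0 ≤ M a b * (p i a - p i b) ^ 2 := by
      intro a b
      rcases eq_or_ne a b with rfl | hab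
      · simp
      · exact mul_nonneg (hoff a b hab).le (sq_nonneg _)
    have hpos : 0 < ∑ a, ∑ b, M a b * (p i a - p i b) ^ 2 := by
      refine Finset.sum_pos' (fun a _ => Finset.sum_nonneg fun b _ => hnn a b)
        ⟨k, Finset.mem_univ _, ?_⟩
      refine Finset.sum_pos' (fun b _ => hnn k b) ⟨j, Finset.mem_univ _, ?_⟩
      exact mul_pos (hoff k j hkj) (sq_pos_iff.2 (sub_ne_zero.2 hne))
    linarith
  have hz : ∑ k, (∑ j, M k j) * u k * p i k = 0 := by
    simp_rw [hconst _ i]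
    rw [← Finset.sum_mul, hu', zero_mul]
  rw [hz]
  simp

/-- A symmetric matrix with positive off-diagonal entries whose eigenvalues with respect to the
row sums avoid `(0, 1)` satisfies the reversed Cauchy–Schwarz inequality. -/
theorem Matrix.IsSymm.mul_le_sq_dotProduct_mulVec {M : Matrix ι ι ℝ} (hM : M.IsSymm)
    (hoff : ∀ i j, i ≠ j → 0 < M i j) (hrow : ∀ i, 0 < ∑ j, M i j)
    (hpull : ∀ v : ι → ℝ, v ⬝ᵥ M *ᵥ v ≤ ∑ i, (M *ᵥ v) i ^ 2 / ∑ j, M i j)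
    (v w : ι → ℝ) (hw : 0 < w ⬝ᵥ M *ᵥ w) :
    (v ⬝ᵥ M *ᵥ v) * (w ⬝ᵥ M *ᵥ w) ≤ (v ⬝ᵥ M *ᵥ w) ^ 2 := by
  rcases le_or_gt (v ⬝ᵥ M *ᵥ v) 0 with hv | hv
  · exact (mul_nonpos_of_nonpos_of_nonneg hv hw.le).trans (sq_nonneg _)
  have hneg := hM.dotProduct_mulVec_nonpos hoff hrow hpull
  set a := 1 ⬝ᵥ M *ᵥ w with ha
  set b := 1 ⬝ᵥ M *ᵥ v with hb
  have ha0 : a ≠ 0 := fun h => (hneg w h).not_gt hw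
  have hb0 : b ≠ 0 := fun h => (hneg v h).not_gt hv
  -- This combination is M-orthogonal to the constants.
  have h := hneg (a • v - b • w) (by
    rw [mulVec_sub, mulVec_smul, mulVec_smul, dotProduct_sub, dotProduct_smul, dotProduct_smul,
      ← ha, ← hb, smul_eq_mul, smul_eq_mul]
    ring)
  simp only [mulVec_sub, mulVec_smul, dotProduct_sub, dotProduct_smul, sub_dotProduct,
    smul_dotProduct, smul_eq_mul, hM.dotProduct_mulVec_comm w v] at h
  set x := v ⬝ᵥ M *ᵥ v
  set y := w ⬝ᵥ M *ᵥ w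
  set z := v ⬝ᵥ M *ᵥ w
  have h3 : a ^ 2 * x + b ^ 2 * y ≤ 2 * (a * b * z) := by linarith
  have h4 : 0 < a ^ 2 * x + b ^ 2 * y := by positivity
  have h5 : (a ^ 2 * x + b ^ 2 * y) ^ 2 ≤ (2 * (a * b * z)) ^ 2 := by gcongr
  -- AM-GM: 4·a²x·b²y ≤ (a²x + b²y)² ≤ 4(abz)².
  have h6 : (a * b) ^ 2 * (x * y) ≤ (a * b) ^ 2 * z ^ 2 := by
    nlinarith [sq_nonneg (a ^ 2 * x - b ^ 2 * y)]
  exact le_of_mul_le_mul_left h6 (by positivity)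

end Hyperbolic

/-! ### The form of the first two elements and its induction -/

section Words

open Finset Matrix

open scoped Classical in
/-- The minimal elements of a finite subset of a poset. -/
noncomputable def minElts {X : Type*} [PartialOrder X] (U : Finset X) : Finset X :=
  U.filter fun x => ∀ y ∈ U, ¬ y < x

open scoped Classical in
/-- The number of linear extensions of the subposet `U`, provided that `#U = k`. -/
noncomputable def numExt {X : Type*} [PartialOrder X] : ℕ → Finset X → ℝ
  | 0, _ => 1
  | k + 1, U => ∑ x ∈ minElts U, numExt k (U.erase x)

open scoped Classical in
/-- Transport of a weight on the minimal elements of `U` to those of `U \ {x}`: the elements that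
become minimal inherit the weight of `x`. -/
noncomputable def inherit {X : Type*} [PartialOrder X] (U : Finset X) (x : X) (v : X → ℝ) :
    X → ℝ := fun y => if y ∈ minElts U then v y else v x

open scoped Classical in
/-- The weighted number of linear extensions of `U` that start with `x`, each weighted by its
second element. Here `#U = k + 2`. -/
noncomputable def secondSum {X : Type*} [PartialOrder X] (k : ℕ) (U : Finset X) (v : X → ℝ)
    (x : X) : ℝ :=
  ∑ y ∈ minElts (U.erase x), inherit U x v y * numExt k ((U.erase x).erase y)

/-- The number of linear extensions of `U`, weighted by their first and second elements. -/
noncomputable def firstTwoForm {X : Type*} [PartialOrder X] (k : ℕ) (U : Finset X)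
    (v w : X → ℝ) : ℝ :=
  ∑ x ∈ minElts U, v x * secondSum k U w x

open scoped Classical in
/-- The matrix of `firstTwoForm`. -/
noncomputable def firstTwoMatrix {X : Type*} [PartialOrder X] (k : ℕ) (U : Finset X) :
    Matrix (minElts U) (minElts U) ℝ :=
  Matrix.of fun x y => if (x : X) = y then
    ∑ z ∈ minElts (U.erase x) with z ∉ minElts U, numExt k ((U.erase x).erase z)
    else numExt k ((U.erase x).erase y)

variable {X : Type*} [PartialOrder X]

open scoped Classical

theorem mem_minElts {U : Finset X} {x : X} : x ∈ minElts U ↔ x ∈ U ∧ ∀ y ∈ U, ¬ y < x := by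
  simp [minElts]

theorem minElts_nonempty {U : Finset X} (hU : U.Nonempty) : (minElts U).Nonempty := by
  obtain ⟨x, hx⟩ := U.exists_minimal hU
  exact ⟨x, mem_minElts.2 ⟨hx.1, fun y hy hlt => hx.not_lt hy hlt⟩⟩

theorem mem_minElts_erase {U : Finset X} {x y : X} (hy : y ∈ minElts U) (hxy : y ≠ x) :
    y ∈ minElts (U.erase x) := by
  rw [mem_minElts] at hy ⊢
  exact ⟨mem_erase.2 ⟨hxy, hy.1⟩, fun z hz => hy.2 z (mem_of_mem_erase hz)⟩

theorem ne_of_mem_minElts_erase {U : Finset X} {x y : X} (hy : y ∈ minElts (U.erase x)) :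
    y ≠ x :=
  (mem_erase.1 (mem_minElts.1 hy).1).1

theorem mem_of_mem_minElts {U : Finset X} {x : X} (hx : x ∈ minElts U) : x ∈ U :=
  (mem_minElts.1 hx).1

theorem lt_of_mem_minElts_erase {U : Finset X} {x y : X} (hy : y ∈ minElts (U.erase x))
    (hy' : y ∉ minElts U) : x < y := by
  rw [mem_minElts] at hy hy'
  have hyU := mem_of_mem_erase hy.1
  by_contra hlt
  refine hy' ⟨hyU, fun z hz hzy => ?_⟩
  rcases eq_or_ne z x with rfl | hzx
  · exact hlt hzy
  · exact hy.2 z (mem_erase.2 ⟨hzx, hz⟩) hzy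

theorem filter_minElts_erase (U : Finset X) (x : X) :
    (minElts (U.erase x)).filter (· ∈ minElts U) = (minElts U).erase x := by
  ext y
  simp only [mem_filter, mem_erase]
  exact ⟨fun h => ⟨ne_of_mem_minElts_erase h.1, h.2⟩, fun h => ⟨mem_minElts_erase h.2 h.1, h.2⟩⟩

theorem card_erase_of_mem_minElts {U : Finset X} {k : ℕ} (hU : #U = k + 1) {x : X}
    (hx : x ∈ minElts U) : #(U.erase x) = k := by
  rw [card_erase_of_mem (mem_of_mem_minElts hx), hU, Nat.add_sub_cancel]

theorem numExt_pos {k : ℕ} {U : Finset X} (hU : #U = k) : 0 < numExt k U := by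
  induction k generalizing U with
  | zero => simp [numExt]
  | succ k ih =>
    exact sum_pos (fun x hx => ih (card_erase_of_mem_minElts hU hx))
      (minElts_nonempty (card_pos.1 (by omega)))

theorem inherit_one (U : Finset X) (x : X) : inherit U x 1 = 1 := by
  ext y
  simp [inherit]

theorem secondSum_one (k : ℕ) (U : Finset X) (x : X) :
    secondSum k U 1 x = numExt (k + 1) (U.erase x) := by
  simp [secondSum, inherit_one, numExt]

/-- The second element of an extension of `U` is the first element of one of `U.erase x`. This
expresses a row of the larger form through the smaller form, as the induction needs. -/
theorem secondSum_succ (k : ℕ) (U : Finset X) (v : X → ℝ) (x : X) :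
    secondSum (k + 1) U v x = firstTwoForm k (U.erase x) (inherit U x v) 1 := by
  simp [secondSum, firstTwoForm, inherit_one, numExt]

theorem firstTwoMatrix_isSymm (k : ℕ) (U : Finset X) : (firstTwoMatrix k U).IsSymm := by
  ext x y
  rcases eq_or_ne x y with rfl | h
  · rfl
  · have h' : (x : X) ≠ y := fun h' => h (Subtype.ext h')
    simp only [transpose_apply, firstTwoMatrix, of_apply]
    rw [if_neg h'.symm, if_neg h', erase_right_comm]

theorem firstTwoMatrix_pos {k : ℕ} {U : Finset X} (hU : #U = k + 2) {x y : minElts U}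
    (h : x ≠ y) : 0 < firstTwoMatrix k U x y := by
  simp only [firstTwoMatrix, of_apply, if_neg (fun h' => h (Subtype.ext h'))]
  refine numExt_pos ?_
  refine card_erase_of_mem_minElts (card_erase_of_mem_minElts hU x.2) ?_
  exact mem_minElts_erase y.2 fun h' => h (Subtype.ext h'.symm)

/-- The diagonal entry collects the elements that become minimal once `x` is removed: all of them
carry the weight `v x`. -/
theorem firstTwoMatrix_mulVec (k : ℕ) (U : Finset X) (v : X → ℝ) (x : minElts U) :
    (firstTwoMatrix k U *ᵥ fun y => v y) x = secondSum k U v x := by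
  have h1 : (firstTwoMatrix k U *ᵥ fun y => v y) x =
      ∑ y ∈ minElts U, (if x.1 = y then
        ∑ z ∈ minElts (U.erase x) with z ∉ minElts U, numExt k ((U.erase x).erase z)
        else numExt k ((U.erase x).erase y)) * v y := by
    rw [← sum_coe_sort (minElts U)]
    rfl
  rw [h1, ← add_sum_erase _ _ x.2, secondSum,
    ← sum_filter_add_sum_filter_not (minElts (U.erase x)) (· ∈ minElts U)
      (fun y => inherit U x v y * numExt k ((U.erase x).erase y)),
    filter_minElts_erase, if_pos rfl, add_comm, sum_mul]
  congr 1
  · refine sum_congr rfl fun y hy => ?_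
    rw [mem_erase] at hy
    rw [if_neg hy.1.symm, inherit, if_pos hy.2, mul_comm]
  · refine sum_congr rfl fun y hy => ?_
    rw [mem_filter] at hy
    rw [inherit, if_neg hy.2, mul_comm]

theorem dotProduct_firstTwoMatrix_mulVec (k : ℕ) (U : Finset X) (v w : X → ℝ) :
    (fun x : minElts U => v x) ⬝ᵥ (firstTwoMatrix k U *ᵥ fun y => w y) =
      firstTwoForm k U v w := by
  rw [firstTwoForm, ← sum_coe_sort]
  simp only [dotProduct, firstTwoMatrix_mulVec]

theorem sum_firstTwoMatrix (k : ℕ) (U : Finset X) (x : minElts U) :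
    ∑ y, firstTwoMatrix k U x y = numExt (k + 1) (U.erase x) := by
  rw [← secondSum_one, ← firstTwoMatrix_mulVec]
  simp [mulVec, dotProduct]

/-- The step from three-letter prefixes to two-letter prefixes, for a single triple. -/
theorem inherit_triple_eq (U : Finset X) (v : X → ℝ) (x y z : X) :
    (if x ∈ minElts U ∧ y ∈ minElts (U.erase x) ∧ z ∈ minElts ((U.erase x).erase y) then
      inherit U x v y * (inherit (U.erase x) y (inherit U x v) z - v x) else 0) =
    (if (x ∈ minElts U ∧ y ∈ minElts U ∧ z ∈ minElts U) ∧ x ≠ y ∧ y ≠ z ∧ z ≠ x then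
      v y * (v z - v x) else 0) +
    (if (x ∈ minElts U ∧ z ∈ minElts U ∧ x ≠ z) ∧ y ∈ minElts (U.erase x) ∧ y ∉ minElts U then
      v x * (v z - v x) else 0) +
    (if (x ∈ minElts U ∧ y ∈ minElts U ∧ x ≠ y) ∧ z ∈ minElts (U.erase y) ∧ z ∉ minElts U then
      v y * (v y - v x) else 0) +
    (if (x ∈ minElts U ∧ y ∈ minElts U ∧ x ≠ y) ∧ z ∈ minElts ((U.erase x).erase y) ∧
        z ∉ minElts (U.erase x) ∧ z ∉ minElts (U.erase y) then
      v y * (v y - v x) else 0) := by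
  by_cases hx : x ∈ minElts U
  swap
  · simp [hx]
  by_cases hy : y ∈ minElts (U.erase x)
  swap
  · have h : ¬ (y ∈ minElts U ∧ x ≠ y) := fun h => hy (mem_minElts_erase h.1 h.2.symm)
    grind
  have hyx := ne_of_mem_minElts_erase hy
  by_cases hym : y ∈ minElts U
  · by_cases hz : z ∈ minElts U
    · have h1 := fun h : z ≠ x => mem_minElts_erase hz h
      have h2 := fun (h : z ≠ x) (h' : z ≠ y) => mem_minElts_erase (mem_minElts_erase hz h) h'
      have h3 := fun h : z ∈ minElts ((U.erase x).erase y) => ne_of_mem_minElts_erase h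
      have h4 := fun h : z ∈ minElts ((U.erase x).erase y) =>
        ne_of_mem_minElts_erase (erase_right_comm (s := U) (a := x) ▸ h)
      have h5 := fun h : z ≠ y => mem_minElts_erase hz h
      simp only [inherit]
      grind
    -- If `z` is released by `y` alone, then `y < z` still blocks it in `U.erase x`. If `z` is
    -- released by `x` alone, it inherits `v x` and contributes zero.
    · have h1 : z ∈ minElts (U.erase y) → z ∉ minElts (U.erase x) := fun h h' =>
        (mem_minElts.1 h').2 y (mem_erase.2 ⟨hyx, mem_of_mem_minElts hym⟩)
          (lt_of_mem_minElts_erase h hz)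
      have hzx : z ≠ x := by rintro rfl; exact hz hx
      have h2 : z ∈ minElts (U.erase y) → z ∈ minElts ((U.erase x).erase y) := fun h => by
        rw [erase_right_comm]; exact mem_minElts_erase h hzx
      simp only [inherit]
      grind
  -- Here `y` carries `v x`, so every `z` not minimal in `U` also carries `v x` and contributes
  -- zero.
  · have h1 : z ∈ minElts U → z ≠ x → z ∈ minElts ((U.erase x).erase y) := fun h h' =>
      mem_minElts_erase (mem_minElts_erase h h') (by rintro rfl; exact hym h)
    have h2 : z ∈ minElts ((U.erase x).erase y) → z ≠ x := fun h =>
      ne_of_mem_minElts_erase (erase_right_comm (s := U) (a := x) ▸ h)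
    have h3 : z ∈ minElts U → z ≠ x → z ∈ minElts (U.erase x) := mem_minElts_erase
    simp only [inherit]
    grind

/-- The difference of the two sides is a sum over three-letter prefixes, split by
`inherit_triple_eq`. The count `g` of completions is symmetric in the letters, so permuting them
cancels everything except the triples whose third letter needs both earlier ones removed; these give
squares. -/
theorem firstTwoForm_succ_le [Fintype X] (k : ℕ) (U : Finset X) (v : X → ℝ) :
    firstTwoForm (k + 1) U v v ≤
      ∑ x ∈ minElts U, firstTwoForm k (U.erase x) (inherit U x v) (inherit U x v) := by
  let g : X → X → X → ℝ := fun x y z => numExt k (((U.erase x).erase y).erase z)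
  have g12 : ∀ x y z, g x y z = g y x z := fun x y z => by
    simp only [g, erase_right_comm (s := U) (a := x)]
  have g23 : ∀ x y z, g x y z = g x z y := fun x y z => by
    simp only [g, erase_right_comm (s := U.erase x) (a := y)]
  have gnn : ∀ x y z, 0 ≤ g x y z := by
    have : ∀ k (U : Finset X), 0 ≤ numExt k U := fun k => by
      induction k with
      | zero => simp [numExt]
      | succ k ih => exact fun U => sum_nonneg fun _ _ => ih _
    exact fun x y z => this _ _
  rw [← sub_nonneg]
  have key : ∑ x ∈ minElts U, firstTwoForm k (U.erase x) (inherit U x v) (inherit U x v) -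
      firstTwoForm (k + 1) U v v = ∑ x, ∑ y, ∑ z,
      (if x ∈ minElts U ∧ y ∈ minElts (U.erase x) ∧ z ∈ minElts ((U.erase x).erase y) then
        inherit U x v y * (inherit (U.erase x) y (inherit U x v) z - v x) else 0) * g x y z := by
    simp only [firstTwoForm, secondSum, numExt, ite_and, ite_mul, zero_mul]
    simp only [sum_ite_irrel, sum_ite_mem, univ_inter, sum_const_zero]
    rw [← sum_sub_distrib]
    refine sum_congr rfl fun x _ => ?_
    rw [mul_sum, ← sum_sub_distrib]
    refine sum_congr rfl fun y _ => ?_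
    rw [mul_sum, mul_sum, mul_sum, ← sum_sub_distrib]
    refine sum_congr rfl fun z _ => ?_
    simp only [g]
    ring
  rw [key]
  simp only [inherit_triple_eq, add_mul, sum_add_distrib]
  set SA := ∑ x, ∑ y, ∑ z,
    (if (x ∈ minElts U ∧ y ∈ minElts U ∧ z ∈ minElts U) ∧ x ≠ y ∧ y ≠ z ∧ z ≠ x then
      v y * (v z - v x) else 0) * g x y z with hSA
  set SB := ∑ x, ∑ y, ∑ z,
    (if (x ∈ minElts U ∧ z ∈ minElts U ∧ x ≠ z) ∧ y ∈ minElts (U.erase x) ∧ y ∉ minElts U then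
      v x * (v z - v x) else 0) * g x y z with hSB
  set SC := ∑ x, ∑ y, ∑ z,
    (if (x ∈ minElts U ∧ y ∈ minElts U ∧ x ≠ y) ∧ z ∈ minElts (U.erase y) ∧ z ∉ minElts U then
      v y * (v y - v x) else 0) * g x y z with hSC
  set SE := ∑ x, ∑ y, ∑ z,
    (if (x ∈ minElts U ∧ y ∈ minElts U ∧ x ≠ y) ∧ z ∈ minElts ((U.erase x).erase y) ∧
        z ∉ minElts (U.erase x) ∧ z ∉ minElts (U.erase y) then
      v y * (v y - v x) else 0) * g x y z with hSE
  -- Exchanging `x` and `z` reverses the sign.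
  have hA : SA + SA = 0 := by
    have h : SA = ∑ x, ∑ y, ∑ z,
      (if (z ∈ minElts U ∧ y ∈ minElts U ∧ x ∈ minElts U) ∧ z ≠ y ∧ y ≠ x ∧ x ≠ z then
        v y * (v x - v z) else 0) * g z y x := by
      rw [hSA, sum_comm]
      conv_rhs => rw [sum_comm]
      exact sum_congr rfl fun y _ => sum_comm
    nth_rewrite 2 [h]
    rw [hSA]
    simp only [← sum_add_distrib]
    refine sum_eq_zero fun x _ => sum_eq_zero fun y _ => sum_eq_zero fun z _ => ?_
    rw [show g z y x = g x y z by rw [g12, g23, g12], ← add_mul]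
    have hc : (z ∈ minElts U ∧ y ∈ minElts U ∧ x ∈ minElts U) ∧ z ≠ y ∧ y ≠ x ∧ x ≠ z ↔
        (x ∈ minElts U ∧ y ∈ minElts U ∧ z ∈ minElts U) ∧ x ≠ y ∧ y ≠ z ∧ z ≠ x :=
      ⟨fun ⟨⟨h1, h2, h3⟩, h4, h5, h6⟩ => ⟨⟨h3, h2, h1⟩, h5.symm, h4.symm, h6.symm⟩,
        fun ⟨⟨h1, h2, h3⟩, h4, h5, h6⟩ => ⟨⟨h3, h2, h1⟩, h5.symm, h4.symm, h6.symm⟩⟩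
    simp only [hc]
    split_ifs <;> ring
  -- A cyclic relabelling turns `SB` into the negative of `SC`.
  have hBC : SB + SC = 0 := by
    have h : SB = ∑ x, ∑ y, ∑ z,
      (if (y ∈ minElts U ∧ x ∈ minElts U ∧ y ≠ x) ∧ z ∈ minElts (U.erase y) ∧ z ∉ minElts U then
        v y * (v x - v y) else 0) * g y z x := by
      rw [hSB]
      conv_rhs => rw [sum_comm]
      refine sum_congr rfl fun y _ => ?_
      exact sum_comm
    rw [h, hSC]
    simp only [← sum_add_distrib]
    refine sum_eq_zero fun x _ => sum_eq_zero fun y _ => sum_eq_zero fun z _ => ?_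
    rw [show g y z x = g x y z by rw [g23, g12], ← add_mul]
    have hc : (y ∈ minElts U ∧ x ∈ minElts U ∧ y ≠ x) ↔ (x ∈ minElts U ∧ y ∈ minElts U ∧ x ≠ y) :=
      ⟨fun ⟨h1, h2, h3⟩ => ⟨h2, h1, h3.symm⟩, fun ⟨h1, h2, h3⟩ => ⟨h2, h1, h3.symm⟩⟩
    simp only [hc]
    split_ifs <;> ring
  -- Symmetrizing in `x` and `y` produces (v x - v y)².
  have hE : 0 ≤ SE + SE := by
    have h : SE = ∑ x, ∑ y, ∑ z,
      (if (y ∈ minElts U ∧ x ∈ minElts U ∧ y ≠ x) ∧ z ∈ minElts ((U.erase y).erase x) ∧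
          z ∉ minElts (U.erase y) ∧ z ∉ minElts (U.erase x) then
        v x * (v x - v y) else 0) * g y x z := by
      rw [hSE, sum_comm]
    nth_rewrite 2 [h]
    rw [hSE]
    simp only [← sum_add_distrib]
    refine sum_nonneg fun x _ => sum_nonneg fun y _ => sum_nonneg fun z _ => ?_
    rw [g12 y x z, ← add_mul, erase_right_comm (s := U) (a := y)]
    refine mul_nonneg ?_ (gnn x y z)
    have hc : (y ∈ minElts U ∧ x ∈ minElts U ∧ y ≠ x) ↔ (x ∈ minElts U ∧ y ∈ minElts U ∧ x ≠ y) :=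
      ⟨fun ⟨h1, h2, h3⟩ => ⟨h2, h1, h3.symm⟩, fun ⟨h1, h2, h3⟩ => ⟨h2, h1, h3.symm⟩⟩
    simp only [hc, and_comm (a := z ∉ minElts (U.erase y))]
    split_ifs
    · linarith [sq_nonneg (v x - v y)]
    · simp
  linarith

theorem firstTwoForm_one_one_pos {k : ℕ} {U : Finset X} (hU : #U = k + 2) :
    0 < firstTwoForm k U 1 1 := by
  refine sum_pos (fun x hx => ?_) (minElts_nonempty (card_pos.1 (by omega)))
  rw [secondSum_one, Pi.one_apply, one_mul]
  exact numExt_pos (card_erase_of_mem_minElts hU hx)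

/-- An antichain gives v_a w_b + v_b w_a, with a square as discriminant; a chain gives the rank-one
form v_a w_a, with equality. -/
theorem firstTwoForm_zero_mul_le {U : Finset X} (hU : #U = 2) (v w : X → ℝ) :
    firstTwoForm 0 U v v * firstTwoForm 0 U w w ≤ firstTwoForm 0 U v w ^ 2 := by
  obtain ⟨a, ha⟩ := minElts_nonempty (card_pos.1 (by omega : 0 < #U))
  obtain ⟨b, hb⟩ := card_eq_one.1 (card_erase_of_mem_minElts (k := 1) hU ha)
  have hab : b ≠ a := (mem_erase.1 (hb ▸ mem_singleton_self b : b ∈ U.erase a)).1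
  have hUab : U = {a, b} := by rw [← insert_erase (mem_of_mem_minElts ha), hb]
  have hsing : ∀ c : X, minElts {c} = {c} := fun c => by
    ext x
    simp only [mem_minElts, mem_singleton]
    exact ⟨fun h => h.1, fun h => ⟨h, fun y hy => by rw [hy, h]; exact lt_irrefl _⟩⟩
  have hsub : minElts U ⊆ {a, b} := fun x hx => hUab ▸ mem_of_mem_minElts hx
  have hba : U.erase b = {a} := by
    rw [hUab, pair_comm, erase_insert (by simpa using hab)]
  by_cases hbm : b ∈ minElts U
  · have hm : minElts U = {a, b} := by
      refine hsub.antisymm fun x hx => ?_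
      rcases mem_insert.1 hx with rfl | h
      · exact ha
      · rwa [mem_singleton.1 h]
    have hQ : ∀ v w : X → ℝ, firstTwoForm 0 U v w = v a * w b + v b * w a := fun v w => by
      rw [firstTwoForm, hm, sum_pair hab.symm]
      simp [secondSum, hb, hba, hsing, inherit, ha, hbm, numExt]
    simp only [hQ]
    nlinarith [sq_nonneg (v a * w b - v b * w a)]
  · have hm : minElts U = {a} := by
      refine Subset.antisymm (fun x hx => ?_) (by simpa using ha)
      rcases mem_insert.1 (hsub hx) with rfl | h
      · simp
      · exact absurd (mem_singleton.1 h ▸ hx) hbm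
    have hQ : ∀ v w : X → ℝ, firstTwoForm 0 U v w = v a * w a := fun v w => by
      rw [firstTwoForm, hm, sum_singleton]
      simp [secondSum, hb, hsing, inherit, hbm, numExt]
    simp only [hQ]
    exact le_of_eq (by ring)

/-- The form counting linear extensions by their first two elements satisfies the reversed
Cauchy–Schwarz inequality. -/
theorem firstTwoForm_mul_le [Fintype X] {k : ℕ} {U : Finset X} (hU : #U = k + 2)
    (v w : X → ℝ) (hw : 0 < firstTwoForm k U w w) :
    firstTwoForm k U v v * firstTwoForm k U w w ≤ firstTwoForm k U v w ^ 2 := by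
  induction k generalizing U v w with
  | zero => exact firstTwoForm_zero_mul_le hU v w
  | succ k ih =>
    have hrow : ∀ x : minElts U, 0 < ∑ y, firstTwoMatrix (k + 1) U x y := fun x => by
      rw [sum_firstTwoMatrix]
      exact numExt_pos (card_erase_of_mem_minElts hU x.2)
    have hpull : ∀ v : minElts U → ℝ, v ⬝ᵥ firstTwoMatrix (k + 1) U *ᵥ v ≤
        ∑ x, (firstTwoMatrix (k + 1) U *ᵥ v) x ^ 2 / ∑ y, firstTwoMatrix (k + 1) U x y := by
      intro v'
      obtain ⟨v, rfl⟩ : ∃ v : X → ℝ, v' = fun x : minElts U => v x :=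
        ⟨fun x => if h : x ∈ minElts U then v' ⟨x, h⟩ else 0, by ext x; simp⟩
      rw [dotProduct_firstTwoMatrix_mulVec]
      refine (firstTwoForm_succ_le k U v).trans ?_
      rw [← sum_coe_sort]
      refine sum_le_sum fun x _ => ?_
      have hc := card_erase_of_mem_minElts hU x.2
      have h1 := firstTwoForm_one_one_pos hc
      rw [firstTwoMatrix_mulVec, sum_firstTwoMatrix, ← secondSum_one, secondSum_succ,
        secondSum_succ, inherit_one, le_div_iff₀ h1]
      -- The induction hypothesis is used with the constant weight 1 as second argument.
      exact ih hc _ _ h1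
    have := (firstTwoMatrix_isSymm (k + 1) U).mul_le_sq_dotProduct_mulVec
      (fun x y h => firstTwoMatrix_pos hU h) hrow hpull (fun x : minElts U => v x)
        (fun x : minElts U => w x)
    simp only [dotProduct_firstTwoMatrix_mulVec] at this
    exact this hw

end Words

/-! ### Linear extensions as words, and the probabilities as values of the form -/

section Counting

open Finset

open scoped Classical in
/-- The elements of `X` that do not occur in a word. -/
noncomputable def remaining {X : Type*} [Fintype X] : List X → Finset X
  | [] => univ
  | x :: w => (remaining w).erase x

/-- A reversed initial segment of a linear extension, as a word. -/
def IsInitialWord {X : Type*} [Fintype X] [PartialOrder X] : List X → Prop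
  | [] => True
  | x :: w => x ∈ minElts (remaining w) ∧ IsInitialWord w

/-- The function `g` numbers the letters of the reversed word by `1, 2, …`. -/
def Numbers {X : Type*} (g : X → ℕ) : List X → Prop
  | [] => True
  | x :: w => g x = w.length + 1 ∧ Numbers g w

open scoped Classical

theorem mem_remaining {X : Type*} [Fintype X] {w : List X} {x : X} : x ∈ remaining w ↔ x ∉ w := by
  induction w with
  | nil => simp [remaining]
  | cons y w ih => simp [remaining, ih]

variable {X : Type*}

theorem Numbers.congr {g g' : X → ℕ} {w : List X} (h : Numbers g w)
    (hg : ∀ x ∈ w, g' x = g x) : Numbers g' w := by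
  induction w with
  | nil => trivial
  | cons x w ih =>
    exact ⟨(hg x (by simp)).trans h.1, ih h.2 fun y hy => hg y (by simp [hy])⟩

theorem Numbers.eq {g g' : X → ℕ} {w : List X} (h : Numbers g w) (h' : Numbers g' w) :
    ∀ x ∈ w, g x = g' x := by
  induction w with
  | nil => simp
  | cons x w ih =>
    intro y hy
    rcases List.mem_cons.1 hy with rfl | hy
    · exact h.1.trans h'.1.symm
    · exact ih h.2 h'.2 y hy

variable [Fintype X] [PartialOrder X]

theorem IsInitialWord.card_remaining {w : List X} (hw : IsInitialWord w) :
    #(remaining w) + w.length = Fintype.card X := by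
  induction w with
  | nil => simp [remaining]
  | cons x w ih =>
    have h := card_erase_add_one (mem_of_mem_minElts hw.1)
    have h' := ih hw.2
    simp only [remaining, List.length_cons]
    omega

/-- The last clause carries the induction: the letters used form a lower set, numbered in increasing
order. -/
theorem IsInitialWord.exists_numbers {w : List X} (hw : IsInitialWord w) :
    ∃ g : X → ℕ, Numbers g w ∧ (∀ x ∈ w, 1 ≤ g x ∧ g x ≤ w.length) ∧
      (∀ x ∈ w, ∀ y ∈ w, g x = g y → x = y) ∧ ∀ y ∈ w, ∀ x < y, x ∈ w ∧ g x < g y := by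
  induction w with
  | nil => exact ⟨fun _ => 0, trivial, by simp, by simp, by simp⟩
  | cons a w ih =>
    obtain ⟨g, h1, h2, h3, h4⟩ := ih hw.2
    have ha := mem_minElts.1 hw.1
    have haw := mem_remaining.1 ha.1
    have hne : ∀ x ∈ w, x ≠ a := by rintro x hx rfl; exact haw hx
    have hup : ∀ x ∈ w, Function.update g a (w.length + 1) x = g x := fun x hx =>
      Function.update_of_ne (hne x hx) _ _
    have hself : Function.update g a (w.length + 1) a = w.length + 1 := Function.update_self ..
    refine ⟨Function.update g a (w.length + 1), ⟨hself, h1.congr hup⟩, fun x hx => ?_,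
      fun x hx y hy hxy => ?_, fun y hy x hxy => ?_⟩
    · rcases List.mem_cons.1 hx with rfl | hx'
      · simp
      · rw [hup x hx', List.length_cons]
        have := h2 x hx'
        omega
    · rcases List.mem_cons.1 hx with hxa | hx' <;> rcases List.mem_cons.1 hy with hya | hy'
      · rw [hxa, hya]
      · rw [hxa, hself, hup y hy'] at hxy
        have := h2 y hy'
        omega
      · rw [hya, hself, hup x hx'] at hxy
        have := h2 x hx'
        omega
      · rw [hup x hx', hup y hy'] at hxy
        exact h3 x hx' y hy' hxy
    · rcases List.mem_cons.1 hy with rfl | hy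
      · have hx : x ∈ w := by
          by_contra hx
          exact ha.2 x (mem_remaining.2 hx) hxy
        refine ⟨List.mem_cons_of_mem _ hx, ?_⟩
        rw [hself, hup x hx]
        have := h2 x hx
        omega
      · have h := h4 y hy x hxy
        rw [hup x h.1, hup y hy]
        exact ⟨List.mem_cons_of_mem _ h.1, h.2⟩

namespace LinExt

theorem apply_mem (f : LinExt X) (x : X) : 1 ≤ f x ∧ f x ≤ Fintype.card X := (f.toEquiv x).2

theorem apply_injective (f : LinExt X) : Function.Injective (f : X → ℕ) :=
  Subtype.val_injective.comp f.toEquiv.injective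

theorem apply_lt (f : LinExt X) {x y : X} (h : x < y) : f x < f y := f.lt_of_lt x y h

theorem exists_apply_eq (f : LinExt X) {i : ℕ} (h1 : 1 ≤ i) (h2 : i ≤ Fintype.card X) :
    ∃ x, f x = i :=
  ⟨f.toEquiv.symm ⟨i, h1, h2⟩, by simp⟩

theorem ext_apply {f g : LinExt X} (h : ∀ x, f x = g x) : f = g :=
  toEquiv_injective (Equiv.ext fun x => Subtype.ext (h x))

theorem mem_iff_of_numbers (f : LinExt X) {w : List X} (h : Numbers f w) (y : X) :
    y ∈ w ↔ f y ≤ w.length := by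
  induction w with
  | nil =>
    have := (f.apply_mem y).1
    simp only [List.not_mem_nil, List.length_nil, false_iff] at this ⊢
    omega
  | cons x w ih =>
    have hx := h.1
    rw [List.mem_cons, ih h.2, List.length_cons, ← f.apply_injective.eq_iff]
    dsimp only at hx ⊢
    omega

theorem existsUnique_numbers {w : List X} (hw : IsInitialWord w)
    (hlen : w.length = Fintype.card X) : ∃! f : LinExt X, Numbers f w := by
  have hall : ∀ x, x ∈ w := by
    intro x
    by_contra hx
    have := card_pos.2 ⟨x, mem_remaining.2 hx⟩
    have := hw.card_remaining
    omega
  obtain ⟨g, h1, h2, h3, h4⟩ := hw.exists_numbers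
  let e : X ≃ Set.Icc 1 (Fintype.card X) :=
    Equiv.ofBijective (fun x => ⟨g x, (h2 x (hall x)).1, hlen ▸ (h2 x (hall x)).2⟩) <| by
      refine (Fintype.bijective_iff_injective_and_card _).2 ⟨fun x y hxy => ?_, by simp⟩
      exact h3 x (hall x) y (hall y) (congrArg Subtype.val hxy)
  refine ⟨⟨e, fun x y hxy => (h4 y (hall y) x hxy).2⟩, h1, fun f hf => ext_apply fun x => ?_⟩
  exact hf.eq h1 x (hall x)

/-- Summation over the linear extensions with a given initial word, by the next letter. -/
theorem sum_numbers_eq [Fintype (LinExt X)] {w : List X} (hlen : w.length < Fintype.card X)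
    (φ : LinExt X → ℝ) :
    ∑ f : LinExt X, (if Numbers f w then φ f else 0) =
      ∑ x ∈ minElts (remaining w), ∑ f : LinExt X, if Numbers f (x :: w) then φ f else 0 := by
  rw [sum_comm]
  refine sum_congr rfl fun f _ => ?_
  by_cases hf : Numbers f w
  -- The only possible next letter is the element with value `w.length + 1`.
  · obtain ⟨a, ha⟩ := f.exists_apply_eq (i := w.length + 1) (by omega) (by omega)
    have ham : a ∈ minElts (remaining w) := by
      refine mem_minElts.2 ⟨mem_remaining.2 fun h => ?_, fun y hy hya => ?_⟩
      · have := (f.mem_iff_of_numbers hf a).1 h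
        omega
      · refine mem_remaining.1 hy ((f.mem_iff_of_numbers hf y).2 ?_)
        have := f.apply_lt hya
        omega
    rw [sum_eq_single_of_mem a ham, if_pos hf, if_pos ⟨ha, hf⟩]
    intro x _ hxa
    exact if_neg fun h => hxa (f.apply_injective (h.1.trans ha.symm))
  · rw [if_neg hf]
    exact (sum_eq_zero fun x _ => if_neg fun h => hf h.2).symm

theorem card_numbers [Fintype (LinExt X)] {k : ℕ} {w : List X} (hw : IsInitialWord w)
    (hk : w.length + k = Fintype.card X) :
    ∑ f : LinExt X, (if Numbers f w then (1 : ℝ) else 0) = numExt k (remaining w) := by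
  induction k generalizing w with
  | zero =>
    obtain ⟨f, hf, huniq⟩ := existsUnique_numbers hw hk
    rw [sum_eq_single f, if_pos hf, numExt]
    · exact fun g _ hg => if_neg fun h => hg (huniq g h)
    · simp
  | succ k ih =>
    rw [sum_numbers_eq (by omega), numExt]
    refine sum_congr rfl fun x hx => ?_
    exact ih ⟨hx, hw⟩ (by simp only [List.length_cons]; omega)

theorem unif_real_eq [Fintype (LinExt X)] (S : Set (LinExt X)) :
    (unif X).real S = (∑ f : LinExt X, if f ∈ S then (1 : ℝ) else 0) / Fintype.card (LinExt X) := by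
  have h : unif X S = (#(univ.filter (· ∈ S)) : ENNReal) / #(univ : Finset (LinExt X)) := by
    have := uniformOn_apply_finset (s := (univ : Finset (LinExt X))) (t := univ.filter (· ∈ S))
    simpa [unif] using this
  rw [measureReal_def, h, ENNReal.toReal_div, sum_boole]
  simp

/-- The number of linear extensions that start with an element of `A` and continue with an
element of `S`. -/
theorem sum_first_two [Fintype (LinExt X)] {k : ℕ} (hk : Fintype.card X = k + 2) (A S : Set X) :
    (∑ f : LinExt X, if 1 ∈ f '' A ∧ 2 ∈ f '' S then (1 : ℝ) else 0) =
      ∑ x ∈ minElts (univ : Finset X), ∑ y ∈ minElts (univ.erase x),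
        if x ∈ A ∧ y ∈ S then numExt k ((univ.erase x).erase y) else 0 := by
  set φ : LinExt X → ℝ :=
    fun f => if 1 ∈ f '' A ∧ 2 ∈ f '' S then (1 : ℝ) else 0 with hφ
  have h0 : ∑ f, φ f = ∑ f : LinExt X, if Numbers f [] then φ f else 0 := by simp [Numbers]
  rw [h0, sum_numbers_eq (by simp; omega)]
  refine sum_congr rfl fun x hx => ?_
  rw [sum_numbers_eq (by simp; omega)]
  refine sum_congr rfl fun y hy => ?_
  have hval : ∀ f : LinExt X, Numbers f [y, x] → φ f = if x ∈ A ∧ y ∈ S then 1 else 0 := by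
    rintro f ⟨hfy, hfx, -⟩
    have h1 : 1 ∈ f '' A ↔ x ∈ A := by
      refine ⟨?_, fun h => ⟨x, h, hfx⟩⟩
      rintro ⟨z, hz, hzx⟩
      rwa [← f.apply_injective (hzx.trans hfx.symm)]
    have h2 : 2 ∈ f '' S ↔ y ∈ S := by
      refine ⟨?_, fun h => ⟨y, h, hfy⟩⟩
      rintro ⟨z, hz, hzy⟩
      rwa [← f.apply_injective (hzy.trans hfy.symm)]
    simp only [hφ, h1, h2]
  have hc := card_numbers (k := k) (w := [y, x]) ⟨hy, hx, trivial⟩ (by simp; omega)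
  change _ = if x ∈ A ∧ y ∈ S then numExt k (remaining [y, x]) else 0
  rw [← hc]
  split_ifs with h
  · refine sum_congr rfl fun f _ => ?_
    split_ifs with hf
    · rw [hval f hf, if_pos h]
    · rfl
  · refine sum_eq_zero fun f _ => ?_
    split_ifs with hf
    · rw [hval f hf, if_neg h]
    · rfl

theorem unif_real_first_two [Fintype (LinExt X)] {k : ℕ} (hk : Fintype.card X = k + 2)
    (A S : Set X) :
    (unif X).real {f | 1 ∈ f '' A ∧ 2 ∈ f '' S} =
      (∑ x ∈ minElts (univ : Finset X), ∑ y ∈ minElts (univ.erase x),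
        if x ∈ A ∧ y ∈ S then numExt k ((univ.erase x).erase y) else 0) /
          Fintype.card (LinExt X) := by
  rw [unif_real_eq, ← sum_first_two hk]
  simp only [Set.mem_ofPred_eq]
  congr!

end LinExt

theorem mem_minElts_univ {x : X} : x ∈ minElts (univ : Finset X) ↔ IsMin x := by
  simp [mem_minElts, isMin_iff_forall_not_lt]

/-- A second element that is not minimal in `X` lies above the first, hence above `A`. -/
theorem mem_upperClosure_of_minElts_erase {A : Set X} {x y : X}
    (hx : x ∈ A) (hy : y ∈ minElts (univ.erase x)) :
    y ∈ upperClosure A ↔ y ∈ minElts (univ : Finset X) → y ∈ A := by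
  rw [mem_upperClosure]
  constructor
  · rintro ⟨a, ha, hay⟩ hym
    rwa [← (mem_minElts_univ.1 hym).eq_of_le hay]
  · intro h
    by_cases hym : y ∈ minElts (univ : Finset X)
    · exact ⟨y, h hym, le_rfl⟩
    · exact ⟨x, hx, (lt_of_mem_minElts_erase hy hym).le⟩

theorem firstTwoForm_indicator_self (k : ℕ) (A : Set X) :
    firstTwoForm k univ (A.indicator 1) (A.indicator 1) =
      ∑ x ∈ minElts (univ : Finset X), ∑ y ∈ minElts (univ.erase x),
        if x ∈ A ∧ y ∈ (upperClosure A : Set X) then numExt k ((univ.erase x).erase y) else 0 := by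
  refine sum_congr rfl fun x _ => ?_
  rw [secondSum, mul_sum]
  refine sum_congr rfl fun y hy => ?_
  by_cases hxA : x ∈ A
  · simp only [inherit, SetLike.mem_coe, mem_upperClosure_of_minElts_erase hxA hy]
    by_cases h1 : y ∈ minElts (univ : Finset X) <;> by_cases h2 : y ∈ A <;> simp [hxA, h1, h2]
  · simp [hxA]

/-- A nonminimal second element inherits the weight of `x ∈ A`, which is zero for `B` by
disjointness. -/
theorem firstTwoForm_indicator_of_disjoint (k : ℕ) {A B : Set X} (hB : B ⊆ {x | IsMin x})
    (hAB : Disjoint A B) :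
    firstTwoForm k univ (A.indicator 1) (B.indicator 1) =
      ∑ x ∈ minElts (univ : Finset X), ∑ y ∈ minElts (univ.erase x),
        if x ∈ A ∧ y ∈ B then numExt k ((univ.erase x).erase y) else 0 := by
  refine sum_congr rfl fun x _ => ?_
  rw [secondSum, mul_sum]
  refine sum_congr rfl fun y hy => ?_
  by_cases hxA : x ∈ A
  · have hxB : x ∉ B := Set.disjoint_left.1 hAB hxA
    have hyB : y ∈ B → y ∈ minElts (univ : Finset X) := fun h => mem_minElts_univ.2 (hB h)
    simp only [inherit]
    by_cases h1 : y ∈ minElts (univ : Finset X) <;> by_cases h2 : y ∈ B <;>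
      simp_all
  · simp [hxA]

end Counting

theorem theoremt {X : Type*} [Fintype X] [PartialOrder X] (A B : Set X)
    (hA : A ⊆ {x | IsMin x}) (hB : B ⊆ {x | IsMin x})
    (hA_ne : A.Nonempty) (hB_ne : B.Nonempty) (hAB : Disjoint A B) :
    (LinExt.unif X).real {f | 1 ∈ f '' A ∧ 2 ∈ f '' B} ^ 2 ≥
      (LinExt.unif X).real {f | 1 ∈ f '' A ∧ 2 ∈ f '' (upperClosure A : Set X)} *
        (LinExt.unif X).real {f | 1 ∈ f '' B ∧ 2 ∈ f '' (upperClosure B : Set X)} := by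
  classical
  have := Fintype.ofFinite (LinExt X)
  obtain ⟨a, ha⟩ := hA_ne
  obtain ⟨b, hb⟩ := hB_ne
  have hab : a ≠ b := fun h => Set.disjoint_left.1 hAB ha (h ▸ hb)
  obtain ⟨k, hk⟩ : ∃ k, Fintype.card X = k + 2 :=
    ⟨Fintype.card X - 2, by have := Fintype.one_lt_card_iff.2 ⟨a, b, hab⟩; omega⟩
  rw [LinExt.unif_real_first_two hk, LinExt.unif_real_first_two hk,
    LinExt.unif_real_first_two hk, ← firstTwoForm_indicator_self k A,
    ← firstTwoForm_indicator_self k B, ← firstTwoForm_indicator_of_disjoint k hB hAB,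
    div_pow, div_mul_div_comm, ← pow_two (Fintype.card (LinExt X) : ℝ), ge_iff_le]
  gcongr
  have hcard : Finset.card (Finset.univ : Finset X) = k + 2 := hk
  -- The reversed inequality needs a positive second value; otherwise the product is nonpositive,
  -- since the value at `A` is a count.
  rcases le_or_gt (firstTwoForm k Finset.univ (B.indicator 1) (B.indicator 1)) 0 with h | h
  · refine (mul_nonpos_of_nonneg_of_nonpos ?_ h).trans (sq_nonneg _)
    rw [firstTwoForm_indicator_self k A, ← LinExt.sum_first_two hk]
    exact Finset.sum_nonneg fun f _ => by split_ifs <;> simp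
  · exact firstTwoForm_mul_le hcard _ _ h
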